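/- \textbf{Conventions.} Operator spaces are complete: an operator space is a complex Banach space $E$ with norms $\|\cdot\|_n$ on all $M_n(E)$ (with $\|\cdot\|_1$ the given norm) satisfying Ruan's axioms $\|\alpha x\beta\|_m\le\|\alpha\|\,\|x\|_n\,\|\beta\|$ (for $x\in M_n(E)$ and scalar matrices $\alpha\in M_{m,n}$, $\beta\in M_{n,m}$) and $\|x\oplus y\|_{m+n}=\max\{\|x\|_m,\|y\|_n\}$. $\mathrm{Op}_\infty$ is the category of operator spaces and completely bounded linear maps (not only complete contractions). Let $A$ be a unital operator algebra, that is, a unital Banach algebra with contractive unit and an operator space structure such that the multiplication is completely contractive on the Haagerup tensor product, i.e. $\|ab\|_n\le\|a\|_n\|b\|_n$ for all $a,b\in M_n(A)$. An operator space $E$ that is a unital right $A$-module is a \emph{right operator $A$-module} if the action induces a complete contraction $E\otimes_h A\to E$ on the Haagerup tensor product, i.e. $\bigl\|\bigl[\sum_k x_{ik}\cdot a_{kj}\bigr]\bigr\|_n\le\|x\|_n\|a\|_n$ for all $n$, $x\in M_n(E)$, $a\in M_n(A)$; it is a \emph{matrix normed right $A$-module} if the action induces a complete contraction on the operator space projective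 tensor product of $E$ and $A$, i.e. $\|[x_{ij}\cdot a_{kl}]\|_{nm}\le\|x\|_n\|a\|_m$ for all $n,m$, $x\in M_n(E)$, $a\in M_m(A)$. Let $\mathrm{OMOD}^\infty_A$ and $\mathrm{mnMOD}^\infty_A$ be the categories of these modules, with completely bounded $A$-module maps as morphisms. In an additive category, $\mathcal{E}_{\max}$ is the class of all kernel-cokernel pairs, that is, of composable pairs $(\mu,\pi)$ where $\mu$ is a kernel of $\pi$ and $\pi$ is a cokernel of $\mu$. In $\mathrm{OMOD}^\infty_A$ and $\mathrm{mnMOD}^\infty_A$, $\mathcal{E}_{\mathrm{rel}}\subseteq\mathcal{E}_{\max}$ is the class of those kernel-cokernel pairs $K\xrightarrow{\mu}F\xrightarrow{\pi}C$ that split in $\mathrm{Op}_\infty$: there are completely bounded linear maps $r\colon F\to K$ and $s\colon C\to F$ with $r\mu=\mathrm{id}_K$, $\pi s=\mathrm{id}_C$ and $\mu r+s\pi=\mathrm{id}_F$. For a class $\mathcal{E}$ of kernel-cokernel pairs, $\mu$ is an \emph{admissible monomorphism} if $(\mu,\pi)\in\mathcal{E}$ for some $\pi$, and an object $I$ is \emph{$\mathcal{E}$-injective}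 if for every admissible monomorphism $\mu\colon X\to Y$ and every morphism $f\colon X\to I$ there is a morphism $g\colon Y\to I$ with $g\mu=f$. \textbf{Proposition.} Let $A$ be a unital operator algebra and let $\mathcal{A}$ be either $\mathrm{OMOD}^\infty_A$ or $\mathrm{mnMOD}^\infty_A$. Let $E\in\mathcal{A}$. If $E$ is $\mathcal{E}_{\mathrm{rel}}$-injective in $\mathcal{A}$ and, regarded as an operator space, $\mathcal{E}_{\max}$-injective in $\mathrm{Op}_\infty$, then $E$ is $\mathcal{E}_{\max}$-injective in $\mathcal{A}$. -/

import Mathlib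

open CategoryTheory CategoryTheory.Limits

universe u v

/-! ## Operator spaces -/

/-- The product `α x β` of scalar matrices `α`, `β` with a matrix `x` over a complex vector space. -/
def scalarSandwich {E : Type*} [AddCommGroup E] [Module ℂ E] {m n : ℕ}
    (α : Matrix (Fin m) (Fin n) ℂ) (x : Matrix (Fin n) (Fin n) E)
    (β : Matrix (Fin n) (Fin m) ℂ) : Matrix (Fin m) (Fin m) E :=
  Matrix.of fun i j => ∑ k, ∑ l, (α i k * β l j) • x k l

/-- The block diagonal matrix `x ⊕ y`. -/
def blockDiag {E : Type*} [Zero E] {m n : ℕ}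
    (x : Matrix (Fin m) (Fin m) E) (y : Matrix (Fin n) (Fin n) E) :
    Matrix (Fin (m + n)) (Fin (m + n)) E :=
  Matrix.reindex finSumFinEquiv finSumFinEquiv (Matrix.fromBlocks x 0 0 y)

open scoped Matrix.Norms.L2Operator in
/-- Matrix norms on a complex normed space subject to Ruan's axioms; scalar matrices carry the
operator norm between the Euclidean spaces `ℂⁿ`. (Completeness is a separate assumption.) -/
class OperatorSpace (E : Type*) [NormedAddCommGroup E] [NormedSpace ℂ E] where
  /-- The norm of `M_n(E)`. -/
  mnorm : ∀ n : ℕ, Seminorm ℂ (Matrix (Fin n) (Fin n) E)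
  mnorm_one : ∀ x : E, mnorm 1 (Matrix.of fun _ _ => x) = ‖x‖
  mnorm_sandwich_le : ∀ (m n : ℕ) (α : Matrix (Fin m) (Fin n) ℂ) (x : Matrix (Fin n) (Fin n) E)
    (β : Matrix (Fin n) (Fin m) ℂ),
    mnorm m (scalarSandwich α x β) ≤ ‖α‖ * mnorm n x * ‖β‖
  mnorm_blockDiag : ∀ (m n : ℕ) (x : Matrix (Fin m) (Fin m) E) (y : Matrix (Fin n) (Fin n) E),
    mnorm (m + n) (blockDiag x y) = max (mnorm m x) (mnorm n y)

open OperatorSpace (mnorm)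

/-- A linear map `f` is completely bounded if its amplifications `f_n` to `M_n(E)` are uniformly
bounded. -/
def IsCompletelyBounded {E F : Type*} [NormedAddCommGroup E] [NormedSpace ℂ E] [OperatorSpace E]
    [NormedAddCommGroup F] [NormedSpace ℂ F] [OperatorSpace F] (f : E →ₗ[ℂ] F) : Prop :=
  ∃ C : ℝ, ∀ (n : ℕ) (x : Matrix (Fin n) (Fin n) E), mnorm n (x.map f) ≤ C * mnorm n x

section CompletelyBounded

variable {E F G : Type*} [NormedAddCommGroup E] [NormedSpace ℂ E] [OperatorSpace E]
  [NormedAddCommGroup F] [NormedSpace ℂ F] [OperatorSpace F]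
  [NormedAddCommGroup G] [NormedSpace ℂ G] [OperatorSpace G]

theorem IsCompletelyBounded.id : IsCompletelyBounded (LinearMap.id : E →ₗ[ℂ] E) :=
  ⟨1, fun n x => by
    rw [one_mul]
    exact le_of_eq (congrArg (mnorm n) (Matrix.ext fun _ _ => rfl))⟩

theorem IsCompletelyBounded.comp {g : F →ₗ[ℂ] G} {f : E →ₗ[ℂ] F}
    (hg : IsCompletelyBounded g) (hf : IsCompletelyBounded f) :
    IsCompletelyBounded (g ∘ₗ f) := by
  obtain ⟨C, hC⟩ := hg
  obtain ⟨D, hD⟩ := hf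
  refine ⟨|C| * D, fun n x => ?_⟩
  have h1 : x.map (g ∘ₗ f) = (x.map f).map g := rfl
  rw [h1]
  calc mnorm n ((x.map f).map g) ≤ C * mnorm n (x.map f) := hC n _
    _ ≤ |C| * mnorm n (x.map f) :=
        mul_le_mul_of_nonneg_right (le_abs_self C) (apply_nonneg _ _)
    _ ≤ |C| * (D * mnorm n x) := mul_le_mul_of_nonneg_left (hD n x) (abs_nonneg C)
    _ = |C| * D * mnorm n x := by ring

theorem IsCompletelyBounded.zero : IsCompletelyBounded (0 : E →ₗ[ℂ] F) :=
  ⟨0, fun n x => by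
    have h : x.map (0 : E →ₗ[ℂ] F) = 0 := Matrix.ext fun _ _ => rfl
    rw [h, map_zero, zero_mul]⟩

theorem IsCompletelyBounded.add {f g : E →ₗ[ℂ] F}
    (hf : IsCompletelyBounded f) (hg : IsCompletelyBounded g) : IsCompletelyBounded (f + g) := by
  obtain ⟨C, hC⟩ := hf
  obtain ⟨D, hD⟩ := hg
  refine ⟨C + D, fun n x => ?_⟩
  have h : x.map (f + g : E →ₗ[ℂ] F) = x.map f + x.map g := Matrix.ext fun _ _ => rfl
  rw [h, add_mul]
  exact (map_add_le_add _ _ _).trans (add_le_add (hC n x) (hD n x))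

theorem IsCompletelyBounded.smul (c : ℂ) {f : E →ₗ[ℂ] F} (hf : IsCompletelyBounded f) :
    IsCompletelyBounded (c • f) := by
  obtain ⟨C, hC⟩ := hf
  refine ⟨‖c‖ * C, fun n x => ?_⟩
  have h : x.map (c • f : E →ₗ[ℂ] F) = c • x.map f := Matrix.ext fun _ _ => rfl
  rw [h, map_smul_eq_mul, mul_assoc]
  exact mul_le_mul_of_nonneg_left (hC n x) (norm_nonneg c)

variable (E F) in
/-- `CB(E, F)`, the completely bounded linear maps. -/
def cbMaps : Submodule ℂ (E →ₗ[ℂ] F) where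
  carrier := {f | IsCompletelyBounded f}
  add_mem' := IsCompletelyBounded.add
  zero_mem' := IsCompletelyBounded.zero
  smul_mem' c _ := IsCompletelyBounded.smul c

variable (A : Type*) [Ring A] (E F) in
/-- `CB_A(E, F)`, the completely bounded maps between right `A`-modules that are `A`-linear. -/
def cbModuleMaps [Module Aᵐᵒᵖ E] [Module Aᵐᵒᵖ F] [SMulCommClass ℂ Aᵐᵒᵖ F] :
    Submodule ℂ (E →ₗ[ℂ] F) where
  carrier := {f | IsCompletelyBounded f ∧
    ∀ (a : A) (x : E), f (MulOpposite.op a • x) = MulOpposite.op a • f x}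
  add_mem' hf hg := ⟨hf.1.add hg.1, fun a x => by
    simp only [LinearMap.add_apply, smul_add, hf.2 a x, hg.2 a x]⟩
  zero_mem' := ⟨IsCompletelyBounded.zero, fun a x => by simp⟩
  smul_mem' c _ hf := ⟨hf.1.smul c, fun a x => by
    rw [LinearMap.smul_apply, LinearMap.smul_apply, hf.2 a x, smul_comm]⟩

end CompletelyBounded

/-- Objects of `Op_∞`: the complete operator spaces. -/
structure OpSpace where
  /-- The underlying Banach space. -/
  carrier : Type v
  [normedAddCommGroup : NormedAddCommGroup carrier]
  [normedSpace : NormedSpace ℂ carrier]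
  [completeSpace : CompleteSpace carrier]
  [operatorSpace : OperatorSpace carrier]

attribute [instance] OpSpace.normedAddCommGroup OpSpace.normedSpace OpSpace.completeSpace
  OpSpace.operatorSpace

/-- The category `Op_∞`: its morphisms are all completely bounded linear maps. -/
instance OpSpace.category : Category.{v} OpSpace.{v} where
  Hom E F := cbMaps E.carrier F.carrier
  id _ := ⟨LinearMap.id, IsCompletelyBounded.id⟩
  comp f g := ⟨g.1 ∘ₗ f.1, IsCompletelyBounded.comp g.2 f.2⟩

instance OpSpace.preadditive : Preadditive OpSpace.{v} where
  homGroup E F := inferInstanceAs (AddCommGroup (cbMaps E.carrier F.carrier))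
  add_comp _ _ _ _ _ g := Subtype.ext (LinearMap.comp_add _ _ g.1)
  comp_add _ _ _ f _ _ := Subtype.ext (LinearMap.add_comp f.1 _ _)

/-! ## Operator algebras and their modules -/

/-- A unital operator algebra, described abstractly: a Banach algebra with a contractive unit and
with an operator space structure for which the multiplication is completely contractive on the
Haagerup tensor product, that is, every `M_n(A)` is submultiplicative. -/
class UnitalOperatorAlgebra (A : Type*) [NormedRing A] [NormedAlgebra ℂ A] [CompleteSpace A]
    extends OperatorSpace A where
  norm_one_le : ‖(1 : A)‖ ≤ 1
  mnorm_mul_le : ∀ (n : ℕ) (a b : Matrix (Fin n) (Fin n) A),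
    mnorm n (a * b) ≤ mnorm n a * mnorm n b

/-- Complete operator spaces that are unital right modules over a complex algebra `A`, the action
being bilinear. -/
structure OpSpaceModule (A : Type u) [Ring A] [Algebra ℂ A] extends OpSpace.{v} where
  [module : Module Aᵐᵒᵖ carrier]
  [isScalarTower : IsScalarTower ℂ Aᵐᵒᵖ carrier]

attribute [instance] OpSpaceModule.module OpSpaceModule.isScalarTower

section Modules

variable (A : Type u) [Ring A] [Algebra ℂ A]

instance OpSpaceModule.smulCommClass (E : OpSpaceModule.{u, v} A) :
    SMulCommClass ℂ Aᵐᵒᵖ E.carrier :=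
  IsScalarTower.to_smulCommClass

/-- The morphisms are the completely bounded `A`-module maps. -/
instance OpSpaceModule.category : Category.{v} (OpSpaceModule.{u, v} A) where
  Hom E F := cbModuleMaps E.carrier F.carrier A
  id _ := ⟨LinearMap.id, IsCompletelyBounded.id, fun _ _ => rfl⟩
  comp f g := ⟨g.1 ∘ₗ f.1, IsCompletelyBounded.comp g.2.1 f.2.1, fun a x => by
    rw [LinearMap.comp_apply, f.2.2 a x, g.2.2 a, LinearMap.comp_apply]⟩

instance OpSpaceModule.preadditive : Preadditive (OpSpaceModule.{u, v} A) where
  homGroup E F := inferInstanceAs (AddCommGroup (cbModuleMaps E.carrier F.carrier A))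
  add_comp _ _ _ _ _ g := Subtype.ext (LinearMap.comp_add _ _ g.1)
  comp_add _ _ _ f _ _ := Subtype.ext (LinearMap.add_comp f.1 _ _)

/-- The functor to `Op_∞` that forgets the module action. -/
def OpSpaceModule.forget : OpSpaceModule.{u, v} A ⥤ OpSpace.{v} where
  obj E := E.toOpSpace
  map f := ⟨f.1, f.2.1⟩

instance OpSpaceModule.forget_additive : (OpSpaceModule.forget.{u, v} A).Additive where
  map_add := rfl

end Modules

section OperatorModules

variable (A : Type u) [NormedRing A] [NormedAlgebra ℂ A] [CompleteSpace A]
  [UnitalOperatorAlgebra A]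

/-- `E` is a right operator `A`-module: the action is (multiplicatively) completely contractive,
`‖[∑ₖ x i k · a k j]‖ₙ ≤ ‖x‖ₙ ‖a‖ₙ`, that is, it induces a complete contraction on the Haagerup
tensor product of `E` and `A`. (Rectangular factorizations reduce to square ones by padding with
zeros.) -/
def IsOperatorModule : ObjectProperty (OpSpaceModule.{u, v} A) := fun E =>
  ∀ (n : ℕ) (x : Matrix (Fin n) (Fin n) E.carrier) (a : Matrix (Fin n) (Fin n) A),
    mnorm n (Matrix.of fun i j => ∑ k, MulOpposite.op (a k j) • x i k) ≤ mnorm n x * mnorm n a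

/-- `E` is a matrix normed right `A`-module: the action is jointly completely contractive,
`‖[x i j · a k l]‖ₙₘ ≤ ‖x‖ₙ ‖a‖ₘ`, that is, it induces a complete contraction on the operator space
projective tensor product of `E` and `A`. -/
def IsMatrixNormedModule : ObjectProperty (OpSpaceModule.{u, v} A) := fun E =>
  ∀ (n m : ℕ) (x : Matrix (Fin n) (Fin n) E.carrier) (a : Matrix (Fin m) (Fin m) A),
    mnorm (n * m) (Matrix.reindex finProdFinEquiv finProdFinEquiv
      (Matrix.of fun (p q : Fin n × Fin m) => MulOpposite.op (a p.2 q.2) • x p.1 q.1)) ≤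
        mnorm n x * mnorm m a

/-- The category of right operator `A`-modules and completely bounded `A`-module maps. -/
abbrev OMod := (IsOperatorModule.{u, v} A).FullSubcategory

/-- The category of matrix normed right `A`-modules and completely bounded `A`-module maps. -/
abbrev MnMod := (IsMatrixNormedModule.{u, v} A).FullSubcategory

/-- The forgetful functor from operator modules to operator spaces. -/
abbrev OMod.forget : OMod.{u, v} A ⥤ OpSpace.{v} :=
  (IsOperatorModule.{u, v} A).ι ⋙ OpSpaceModule.forget A

/-- The forgetful functor from matrix normed modules to operator spaces. -/
abbrev MnMod.forget : MnMod.{u, v} A ⥤ OpSpace.{v} :=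
  (IsMatrixNormedModule.{u, v} A).ι ⋙ OpSpaceModule.forget A

end OperatorModules

/-! ## Exact structures and injectivity -/

section Exact

variable {C D : Type*} [Category C] [Category D] [Preadditive C] [Preadditive D]

variable (C) in
/-- The maximal class: the pairs `(μ, π)` in which `μ` is a kernel of `π` and `π` is a cokernel
of `μ`. -/
def exactMax : ObjectProperty (ShortComplex C) := fun S =>
  Nonempty (IsLimit (KernelFork.ofι S.f S.zero)) ∧
    Nonempty (IsColimit (CokernelCofork.ofπ S.g S.zero))

/-- The relative class: the kernel-cokernel pairs that are split after applying the functor `F`. -/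
def exactRel (F : C ⥤ D) [F.Additive] : ObjectProperty (ShortComplex C) := fun S =>
  exactMax C S ∧ Nonempty (S.map F).Splitting

/-- The admissible monomorphisms of a class of kernel-cokernel pairs. -/
def admissibleMono (𝓔 : ObjectProperty (ShortComplex C)) : MorphismProperty C := fun _ Y μ =>
  ∃ (Z : C) (π : Y ⟶ Z) (w : μ ≫ π = 0), 𝓔 (ShortComplex.mk μ π w)

/-- `I` is injective with respect to the class `𝓔`: every morphism to `I` extends along every
admissible monomorphism. -/
def IsInjectiveFor (𝓔 : ObjectProperty (ShortComplex C)) (I : C) : Prop :=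
  ∀ ⦃X Y : C⦄ (μ : X ⟶ Y), admissibleMono 𝓔 μ → ∀ f : X ⟶ I, ∃ g : Y ⟶ I, μ ≫ g = f

end Exact

/-! ## Injectivity along functors preserving kernels and cokernels -/

section Abstract

variable {C D : Type*} [Category C] [Category D] [Preadditive C] [Preadditive D]

/-! Let `μ : X ⟶ Y` be a kernel with cokernel `p : Y ⟶ Z`, and let `f : X ⟶ E` be the morphism to be
extended. Push `μ` out along `f` to get `E ⟶ P ⟶ Z`. The forgetful functor to `Op_∞` preserves
kernels, cokernels and hence pushouts, so injectivity of the operator space `E` extends `f` to a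
completely bounded, not necessarily `A`-linear, map `g : Y ⟶ E`. By the universal property, `g` and
the identity of `E` glue to a linear retraction of `E ⟶ P`, so the pushed-out sequence splits in
`Op_∞` and belongs to the relative class. Relative injectivity then gives an `A`-linear retraction
`P ⟶ E`, and composing it with `Y ⟶ P` extends `f`.

This argument is `isInjectiveFor_exactMax_of_exactRel`. It needs a module category with kernels,
cokernels and biproducts, and a forgetful functor that preserves the first two and reflects
isomorphisms. Kernels are closed submodules, cokernels are quotients by the closure of the range,
and biproducts carry the maximum norm. Both module conditions survive these constructions
(`IsStable`), and the same objects are the kernels and cokernels in `Op_∞`. -/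

theorem exactMax.map {F : C ⥤ D} [F.Additive]
    [∀ {X Y : C} (f : X ⟶ Y), PreservesLimit (parallelPair f 0) F]
    [∀ {X Y : C} (f : X ⟶ Y), PreservesColimit (parallelPair f 0) F]
    {S : ShortComplex C} (hS : exactMax C S) : exactMax D (S.map F) :=
  ⟨hS.1.map (isLimitForkMapOfIsLimit' F S.zero),
    hS.2.map (isColimitCoforkMapOfIsColimit' F S.zero)⟩

/-- A cokernel of `f` induces a cokernel of any pushout of `f`. -/
theorem CategoryTheory.IsPushout.nonempty_isColimit_cokernelCofork {X Y Z I P : C}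
    {f : X ⟶ Y} {h : X ⟶ I} {inl : Y ⟶ P} {inr : I ⟶ P} (sq : IsPushout f h inl inr)
    {p : Y ⟶ Z} {w : f ≫ p = 0} (hp : IsColimit (CokernelCofork.ofπ p w))
    {q : P ⟶ Z} (hl : inl ≫ q = p) (hr : inr ≫ q = 0) :
    Nonempty (IsColimit (CokernelCofork.ofπ q hr)) := by
  have hepi : Epi p := epi_of_isColimit_cofork hp
  have hq : Epi q := ⟨fun a b hab => by
    rw [← cancel_epi p, ← hl, Category.assoc, Category.assoc, hab]⟩
  refine ⟨CokernelCofork.IsColimit.ofπ' q hr fun {W} k hk => ?_⟩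
  have hfk : f ≫ inl ≫ k = 0 := by rw [sq.w_assoc, hk, comp_zero]
  refine ⟨hp.desc (CokernelCofork.ofπ (inl ≫ k) hfk), sq.hom_ext ?_ ?_⟩
  · rw [reassoc_of% hl]
    exact hp.fac (CokernelCofork.ofπ (inl ≫ k) hfk) WalkingParallelPair.one
  · rw [reassoc_of% hr, hk, zero_comp]

/-- The pushout of a kernel-cokernel pair `f`, `p` along a morphism `h` that extends along `f`
splits. -/
theorem CategoryTheory.IsPushout.nonempty_splitting {X Y Z I P : C}
    {f : X ⟶ Y} {h : X ⟶ I} {inl : Y ⟶ P} {inr : I ⟶ P} (sq : IsPushout f h inl inr)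
    {p : Y ⟶ Z} {w : f ≫ p = 0} (hp : IsColimit (CokernelCofork.ofπ p w))
    {q : P ⟶ Z} (hl : inl ≫ q = p) (hr : inr ≫ q = 0) {g : Y ⟶ I} (hg : f ≫ g = h) :
    Nonempty (ShortComplex.mk inr q hr).Splitting := by
  have hepi : Epi p := epi_of_isColimit_cofork hp
  -- The section of `q` comes from correcting `inl` by `g ≫ inr`: the difference kills `f`, so it
  -- descends along the cokernel `p`.
  have hk : f ≫ (inl - g ≫ inr) = 0 := by
    rw [Preadditive.comp_sub, sq.w, reassoc_of% hg, sub_self]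
  obtain ⟨s, hs⟩ : ∃ s : Z ⟶ P, p ≫ s = inl - g ≫ inr :=
    ⟨hp.desc (CokernelCofork.ofπ _ hk), hp.fac (CokernelCofork.ofπ _ hk) WalkingParallelPair.one⟩
  have hr1 : f ≫ g = h ≫ 𝟙 I := by rw [hg, Category.comp_id]
  refine ⟨{ r := sq.desc g (𝟙 I) hr1, s := s, f_r := sq.inr_desc _ _ _, s_g := ?_, id := ?_ }⟩
  · change s ≫ q = 𝟙 Z
    rw [← cancel_epi p, reassoc_of% hs, Preadditive.sub_comp, Category.assoc, hr, hl, comp_zero,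
      sub_zero, Category.comp_id]
  · change sq.desc g (𝟙 I) hr1 ≫ inr + q ≫ s = 𝟙 P
    apply sq.hom_ext
    · rw [Preadditive.comp_add, sq.inl_desc_assoc, reassoc_of% hl, hs, Category.comp_id]
      abel
    · rw [Preadditive.comp_add, sq.inr_desc_assoc, reassoc_of% hr, zero_comp, add_zero,
        Category.id_comp, Category.comp_id]

/-- If `k ≫ S.g = 0`, composing `k` with the splitting identity leaves `k = k ≫ r ≫ S.f`, so `k ≫ r`
is the lift. -/
theorem CategoryTheory.ShortComplex.Splitting.nonempty_isLimit_kernelFork {S : ShortComplex C}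
    (s : S.Splitting) : Nonempty (IsLimit (KernelFork.ofι S.f S.zero)) := by
  have : Mono S.f := s.mono_f
  refine ⟨KernelFork.IsLimit.ofι' S.f S.zero fun {W} k hk => ⟨k ≫ s.r, ?_⟩⟩
  have h := k ≫= s.id
  rwa [Preadditive.comp_add, reassoc_of% hk, zero_comp, add_zero, Category.comp_id,
    ← Category.assoc] at h

theorem isInjectiveFor_exactMax_of_exactRel [HasKernels C] [HasCokernels C]
    [HasBinaryBiproducts C] (F : C ⥤ D) [F.Additive] [F.ReflectsIsomorphisms]
    [∀ {X Y : C} (f : X ⟶ Y), PreservesLimit (parallelPair f 0) F]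
    [∀ {X Y : C} (f : X ⟶ Y), PreservesColimit (parallelPair f 0) F]
    {I : C}
    (hrel : IsInjectiveFor (exactRel F) I) (hmax : IsInjectiveFor (exactMax D) (F.obj I)) :
    IsInjectiveFor (exactMax C) I := by
  rintro X Y μ ⟨Z, p, w, hS⟩ f
  have hFS := hS.map (F := F)
  obtain ⟨g, hg⟩ := hmax (F.map μ) ⟨_, _, _, hFS⟩ (F.map f)
  have := Preadditive.hasCoequalizers_of_hasCokernels (C := C)
  have := hasPushouts_of_hasBinaryCoproducts_of_hasCoequalizers C
  -- Preservation of finite colimits asks for zero objects; the kernel of an identity is one, and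
  -- `F` carries it to one in `D`.
  have hzero : IsZero (kernel (𝟙 I)) := (IsZero.iff_id_eq_zero _).2 <| by
    rw [← cancel_mono (kernel.ι (𝟙 I)), zero_comp, Category.id_comp]
    simpa using kernel.condition (𝟙 I)
  have : HasZeroObject C := ⟨_, hzero⟩
  have : HasZeroObject D := ⟨_, F.map_isZero hzero⟩
  have := hasFiniteCoproducts_of_has_binary_and_initial (C := C)
  have := F.preservesFiniteColimits_of_preservesCokernels
  have sq := IsPushout.of_hasPushout μ f
  have hq : μ ≫ p = f ≫ 0 := by rw [w, comp_zero]
  obtain ⟨q, hl, hr⟩ : ∃ q : pushout μ f ⟶ Z, pushout.inl μ f ≫ q = p ∧ pushout.inr μ f ≫ q = 0 :=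
    ⟨sq.desc p 0 hq, sq.inl_desc _ _ _, sq.inr_desc _ _ _⟩
  obtain ⟨-, ⟨hp⟩⟩ := hS
  obtain ⟨-, ⟨hFp⟩⟩ := hFS
  have hl' : F.map (pushout.inl μ f) ≫ F.map q = F.map p := by rw [← F.map_comp, hl]
  have hr' : F.map (pushout.inr μ f) ≫ F.map q = 0 := by rw [← F.map_comp, hr, F.map_zero]
  -- The extension `g` exists only in `D`, so the splitting is that of the image of the pushout
  -- under `F`.
  obtain ⟨s⟩ := (sq.map F).nonempty_splitting hFp hl' hr' hg
  obtain ⟨hker⟩ := s.nonempty_isLimit_kernelFork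
  -- A functor that preserves an existing limit and reflects isomorphisms also reflects that limit,
  -- so `inr` is a kernel of `q` already in `C`.
  have : ReflectsLimit (parallelPair q 0) F := reflectsLimit_of_reflectsIsomorphisms _ _
  have hker' : IsLimit (KernelFork.ofι (pushout.inr μ f) hr) :=
    isLimitOfReflects F ((isLimitMapConeForkEquiv' F hr).symm hker)
  obtain ⟨r, hr1⟩ := hrel (pushout.inr μ f)
    ⟨Z, q, hr, ⟨⟨⟨hker'⟩, sq.nonempty_isColimit_cokernelCofork hp hl hr⟩, ⟨s⟩⟩⟩ (𝟙 I)
  exact ⟨pushout.inl μ f ≫ r, by rw [sq.w_assoc, hr1, Category.comp_id]⟩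

end Abstract

open OperatorSpace (mnorm_one mnorm_sandwich_le mnorm_blockDiag)
open scoped Matrix

/-! ## Quotient seminorms -/

namespace Seminorm

variable {V W : Type*} [AddCommGroup V] [Module ℂ V]

theorem iInf_fiber_le (p : Seminorm ℂ V) (q : V → W) {v : V} {w : W} (h : q v = w) :
    ⨅ v : {v // q v = w}, p v ≤ p v :=
  ciInf_le ⟨0, by rintro _ ⟨v, rfl⟩; exact apply_nonneg p _⟩ (⟨v, h⟩ : {v // q v = w})

theorem exists_lt_of_iInf_fiber_lt (p : Seminorm ℂ V) {q : V → W} (hq : Function.Surjective q)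
    {w : W} {r : ℝ} (h : ⨅ v : {v // q v = w}, p v < r) : ∃ v, q v = w ∧ p v < r := by
  have : Nonempty {v // q v = w} := (hq w).elim fun v hv => ⟨⟨v, hv⟩⟩
  obtain ⟨⟨v, hv⟩, hr⟩ := exists_lt_of_ciInf_lt h
  exact ⟨v, hv, hr⟩

variable [AddCommGroup W] [Module ℂ W]

/-- The quotient seminorm along a surjective linear map. -/
noncomputable def quotient (p : Seminorm ℂ V) (q : V →ₗ[ℂ] W) (hq : Function.Surjective q) :
    Seminorm ℂ W :=
  Seminorm.ofSMulLE (fun w => ⨅ v : {v // q v = w}, p v)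
    (le_antisymm ((p.iInf_fiber_le q (map_zero q)).trans_eq (map_zero p))
      (Real.iInf_nonneg fun _ => apply_nonneg p _))
    (fun x y => by
      refine le_of_forall_pos_lt_add fun ε hε => ?_
      obtain ⟨v, rfl, hv⟩ := p.exists_lt_of_iInf_fiber_lt hq
        (lt_add_of_pos_right (⨅ v : {v // q v = x}, p v) (half_pos hε))
      obtain ⟨w, rfl, hw⟩ := p.exists_lt_of_iInf_fiber_lt hq
        (lt_add_of_pos_right (⨅ v : {v // q v = y}, p v) (half_pos hε))
      have h1 := p.iInf_fiber_le q (map_add q v w)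
      have h2 := map_add_le_add p v w
      linarith)
    (fun c x => by
      refine le_of_forall_pos_lt_add fun ε hε => ?_
      -- Dividing by `‖c‖ + 1` rather than `‖c‖` covers `c = 0` as well.
      have hc : 0 < ‖c‖ + 1 := by positivity
      obtain ⟨v, rfl, hv⟩ := p.exists_lt_of_iInf_fiber_lt hq
        (lt_add_of_pos_right (⨅ v : {v // q v = x}, p v) (div_pos hε hc))
      have h1 := p.iInf_fiber_le q (map_smul q c v)
      rw [map_smul_eq_mul] at h1
      have h2 : ‖c‖ * (ε / (‖c‖ + 1)) < ε := by
        rw [← mul_div_assoc, div_lt_iff₀ hc]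
        linarith [mul_comm ‖c‖ ε]
      have h3 := mul_le_mul_of_nonneg_left hv.le (norm_nonneg c)
      rw [mul_add] at h3
      linarith)

variable (p : Seminorm ℂ V) (q : V →ₗ[ℂ] W) (hq : Function.Surjective q)

theorem quotient_apply_le (v : V) : p.quotient q hq (q v) ≤ p v :=
  p.iInf_fiber_le q rfl

variable {p q hq} in
theorem exists_lt_of_quotient_lt {w : W} {r : ℝ} (h : p.quotient q hq w < r) :
    ∃ v, q v = w ∧ p v < r :=
  p.exists_lt_of_iInf_fiber_lt hq h

end Seminorm

/-! ## Subspaces, quotients and products of operator spaces -/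

section Matrices

theorem blockDiag_submatrix_castAdd {E : Type*} [Zero E] {m n : ℕ} (x : Matrix (Fin m) (Fin m) E)
    (y : Matrix (Fin n) (Fin n) E) :
    (blockDiag x y).submatrix (Fin.castAdd n) (Fin.castAdd n) = x := by
  ext i j
  simp [blockDiag]

theorem blockDiag_submatrix_natAdd {E : Type*} [Zero E] {m n : ℕ} (x : Matrix (Fin m) (Fin m) E)
    (y : Matrix (Fin n) (Fin n) E) :
    (blockDiag x y).submatrix (Fin.natAdd m) (Fin.natAdd m) = y := by
  ext i j
  simp [blockDiag]

variable {E F : Type*} [AddCommGroup E] [Module ℂ E] [AddCommGroup F] [Module ℂ F]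

theorem scalarSandwich_map (f : E →ₗ[ℂ] F) {m n : ℕ} (α : Matrix (Fin m) (Fin n) ℂ)
    (x : Matrix (Fin n) (Fin n) E) (β : Matrix (Fin n) (Fin m) ℂ) :
    (scalarSandwich α x β).map f = scalarSandwich α (x.map f) β := by
  ext i j
  simp [scalarSandwich, map_sum]

theorem blockDiag_map (f : E →ₗ[ℂ] F) {m n : ℕ} (x : Matrix (Fin m) (Fin m) E)
    (y : Matrix (Fin n) (Fin n) E) :
    (blockDiag x y).map f = blockDiag (x.map f) (y.map f) := by
  have h : (Matrix.fromBlocks x 0 0 y).map f = Matrix.fromBlocks (x.map f) 0 0 (y.map f) := by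
    rw [Matrix.fromBlocks_map, Matrix.map_zero _ (map_zero f), Matrix.map_zero _ (map_zero f)]
  rw [blockDiag, blockDiag, ← h]
  rfl

end Matrices

section OperatorSpaces

variable {E F G : Type*} [NormedAddCommGroup E] [NormedSpace ℂ E] [OperatorSpace E]
  [NormedAddCommGroup F] [NormedSpace ℂ F] [OperatorSpace F]
  [NormedAddCommGroup G] [NormedSpace ℂ G] [OperatorSpace G]

open scoped Matrix.Norms.L2Operator in
-- The submatrix is the compression `βᴴ w β`, where the columns of `β` are the distinct basis
-- vectors selected by `e`. Thus `β` is an isometry and Ruan's first axiom applies.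
theorem mnorm_submatrix_le {m n : ℕ} {e : Fin m → Fin n} (he : Function.Injective e)
    (w : Matrix (Fin n) (Fin n) E) : mnorm m (w.submatrix e e) ≤ mnorm n w := by
  set β : Matrix (Fin n) (Fin m) ℂ := (1 : Matrix (Fin n) (Fin n) ℂ).submatrix id e with hβ
  have h1 : βᴴ * β = 1 := by
    ext i j
    simp [hβ, Matrix.mul_apply, Matrix.one_apply, he.eq_iff, eq_comm]
  have hn : ‖β‖ ≤ 1 := by
    have h := Matrix.l2_opNorm_conjTranspose_mul_self β
    rw [h1] at h
    -- For `m = 0` the identity matrix has norm `0`, so that case is separate.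
    rcases isEmpty_or_nonempty (Fin m) with hm | hm
    · have : β = 0 := by ext i j; exact hm.elim j
      rw [this, norm_zero]
      exact zero_le_one
    · rw [CStarRing.norm_one] at h
      nlinarith [norm_nonneg β]
  have h2 : scalarSandwich βᴴ w β = w.submatrix e e := by
    ext i j
    simp [scalarSandwich, hβ, Matrix.one_apply]
  have h3 := OperatorSpace.mnorm_sandwich_le m n βᴴ w β
  rw [h2, Matrix.l2_opNorm_conjTranspose] at h3
  have h4 : 0 ≤ mnorm n w := apply_nonneg _ _
  calc _ ≤ _ := h3
    _ ≤ 1 * mnorm n w * 1 := by gcongr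
    _ = mnorm n w := by ring

theorem IsCompletelyBounded.exists_nonneg {f : E →ₗ[ℂ] F} (hf : IsCompletelyBounded f) :
    ∃ C : ℝ, 0 ≤ C ∧ ∀ (n : ℕ) (x : Matrix (Fin n) (Fin n) E),
      mnorm n (x.map f) ≤ C * mnorm n x := by
  obtain ⟨C, hC⟩ := hf
  exact ⟨|C|, abs_nonneg C, fun n x => (hC n x).trans
    (mul_le_mul_of_nonneg_right (le_abs_self C) (apply_nonneg _ _))⟩

theorem IsCompletelyBounded.continuous {f : E →ₗ[ℂ] F} (hf : IsCompletelyBounded f) :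
    Continuous f := by
  obtain ⟨C, hC⟩ := hf
  refine AddMonoidHomClass.continuous_of_bound f C fun x => ?_
  rw [← OperatorSpace.mnorm_one, ← OperatorSpace.mnorm_one]
  exact hC 1 _

/-- A completely bounded map into the range of a completely isometric map lifts. -/
theorem IsCompletelyBounded.exists_lift {i : E →ₗ[ℂ] F} (hinj : Function.Injective i)
    (hi : ∀ n (x : Matrix (Fin n) (Fin n) E), mnorm n x = mnorm n (x.map i))
    {k : G →ₗ[ℂ] F} (hk : IsCompletelyBounded k) (hrange : ∀ x, k x ∈ LinearMap.range i) :
    ∃ l : G →ₗ[ℂ] E, IsCompletelyBounded l ∧ ∀ x, i (l x) = k x := by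
  let e := LinearEquiv.ofInjective i hinj
  have h : ∀ x, i (e.symm (k.codRestrict _ hrange x)) = k x := fun x =>
    congrArg Subtype.val (e.apply_symm_apply (k.codRestrict _ hrange x))
  refine ⟨e.symm.toLinearMap ∘ₗ k.codRestrict _ hrange, ?_, h⟩
  obtain ⟨C, hC⟩ := hk
  refine ⟨C, fun n x => ?_⟩
  rw [hi]
  convert hC n x using 2
  ext a b
  exact h _

/-- A completely bounded map vanishing on the kernel of a complete quotient map factors. -/
theorem IsCompletelyBounded.exists_desc {q : E →ₗ[ℂ] F} (hsurj : Function.Surjective q)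
    (hq : ∀ n (z : Matrix (Fin n) (Fin n) F) (r : ℝ), mnorm n z < r →
      ∃ y : Matrix (Fin n) (Fin n) E, y.map q = z ∧ mnorm n y < r)
    {k : E →ₗ[ℂ] G} (hk : IsCompletelyBounded k) (hker : ∀ x, q x = 0 → k x = 0) :
    ∃ l : F →ₗ[ℂ] G, IsCompletelyBounded l ∧ ∀ x, l (q x) = k x := by
  let e := q.quotKerEquivOfSurjective hsurj
  let l : F →ₗ[ℂ] G := (LinearMap.ker q).liftQ k hker ∘ₗ e.symm.toLinearMap
  have h : ∀ x, l (q x) = k x := fun x => by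
    have h1 : e.symm (q x) = Submodule.Quotient.mk x := by
      rw [LinearEquiv.symm_apply_eq]
      rfl
    change (LinearMap.ker q).liftQ k hker (e.symm (q x)) = k x
    rw [h1]
    rfl
  refine ⟨l, ?_, h⟩
  obtain ⟨C, hC0, hC⟩ := hk.exists_nonneg
  refine ⟨C, fun n z => le_of_forall_pos_lt_add fun ε hε => ?_⟩
  have hC1 : 0 < C + 1 := by positivity
  obtain ⟨y, rfl, hy⟩ := hq n z _ (lt_add_of_pos_right (mnorm n z) (div_pos hε hC1))
  have h1 : (y.map q).map l = y.map k := by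
    ext a b
    exact h _
  rw [h1]
  have h2 : C * (ε / (C + 1)) < ε := by
    rw [← mul_div_assoc, div_lt_iff₀ hC1]
    linarith [mul_comm C ε]
  have h3 := mul_le_mul_of_nonneg_left hy.le hC0
  rw [mul_add] at h3
  linarith [hC n y]

open scoped Matrix.Norms.L2Operator in
noncomputable instance OperatorSpace.instProd : OperatorSpace (E × F) where
  mnorm n := ((mnorm n).comp (LinearMap.mapMatrix (LinearMap.fst ℂ E F))) ⊔
    ((mnorm n).comp (LinearMap.mapMatrix (LinearMap.snd ℂ E F)))
  mnorm_one x := by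
    rw [Prod.norm_def, ← mnorm_one x.1, ← mnorm_one x.2]
    rfl
  mnorm_sandwich_le m n α x β := by
    refine sup_le ?_ ?_
    · refine (congrArg (mnorm m) (scalarSandwich_map (LinearMap.fst ℂ E F) α x β)).trans_le
        ((mnorm_sandwich_le m n α _ β).trans ?_)
      gcongr
      exact le_sup_left (α := ℝ)
    · refine (congrArg (mnorm m) (scalarSandwich_map (LinearMap.snd ℂ E F) α x β)).trans_le
        ((mnorm_sandwich_le m n α _ β).trans ?_)
      gcongr
      exact le_sup_right (α := ℝ)
  mnorm_blockDiag m n x y := by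
    refine Eq.trans (congrArg₂ max
      ((congrArg (mnorm _) (blockDiag_map (LinearMap.fst ℂ E F) x y)).trans
        (mnorm_blockDiag m n _ _))
      ((congrArg (mnorm _) (blockDiag_map (LinearMap.snd ℂ E F) x y)).trans
        (mnorm_blockDiag m n _ _))) (max_max_max_comm _ _ _ _)

theorem mnorm_prod_le_mul {m n : ℕ} {w : Matrix (Fin m) (Fin m) (E × F)}
    {x : Matrix (Fin n) (Fin n) (E × F)} {B : ℝ} (hB : 0 ≤ B)
    (h1 : mnorm m (w.map Prod.fst) ≤ mnorm n (x.map Prod.fst) * B)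
    (h2 : mnorm m (w.map Prod.snd) ≤ mnorm n (x.map Prod.snd) * B) :
    mnorm m w ≤ mnorm n x * B :=
  (max_le_max h1 h2).trans_eq (max_mul_of_nonneg _ _ hB).symm

theorem IsCompletelyBounded.fst : IsCompletelyBounded (LinearMap.fst ℂ E F) :=
  ⟨1, fun _ _ => (le_max_left _ _).trans_eq (one_mul _).symm⟩

theorem IsCompletelyBounded.snd : IsCompletelyBounded (LinearMap.snd ℂ E F) :=
  ⟨1, fun _ _ => (le_max_right _ _).trans_eq (one_mul _).symm⟩

theorem IsCompletelyBounded.prod {f : G →ₗ[ℂ] E} {g : G →ₗ[ℂ] F} (hf : IsCompletelyBounded f)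
    (hg : IsCompletelyBounded g) : IsCompletelyBounded (f.prod g) := by
  obtain ⟨C, hC⟩ := hf
  obtain ⟨D, hD⟩ := hg
  refine ⟨max C D, fun n x => max_le ((hC n x).trans ?_) ((hD n x).trans ?_)⟩
  · exact mul_le_mul_of_nonneg_right (le_max_left _ _) (apply_nonneg _ _)
  · exact mul_le_mul_of_nonneg_right (le_max_right _ _) (apply_nonneg _ _)

/-! ### Matrix norms on submodules and quotients -/

variable {R : Type*} [Ring R] [SMul ℂ R] [Module R E] [IsScalarTower ℂ R E] (K : Submodule R E)

noncomputable instance OperatorSpace.instSubmodule : OperatorSpace K where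
  mnorm n := Seminorm.comp (mnorm n : Seminorm ℂ (Matrix (Fin n) (Fin n) E))
    (LinearMap.mapMatrix (K.subtype.restrictScalars ℂ))
  mnorm_one x := mnorm_one (x : E)
  mnorm_sandwich_le m n α x β :=
    (congrArg (mnorm m) (scalarSandwich_map (K.subtype.restrictScalars ℂ) α x β)).trans_le
      (mnorm_sandwich_le m n α _ β)
  mnorm_blockDiag m n x y :=
    (congrArg (mnorm _) (blockDiag_map (K.subtype.restrictScalars ℂ) x y)).trans
      (mnorm_blockDiag m n _ _)

omit [OperatorSpace E] in
theorem Submodule.mapMatrix_mkQ_surjective (n : ℕ) : Function.Surjective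
    (LinearMap.mapMatrix (m := Fin n) (n := Fin n) (K.mkQ.restrictScalars ℂ)) := fun z =>
  ⟨Matrix.of fun i j => (z i j).out, by ext i j; exact Quotient.out_eq _⟩

/-- The quotient seminorms on the matrices over `E ⧸ K`. -/
noncomputable def quotientMnorm (n : ℕ) : Seminorm ℂ (Matrix (Fin n) (Fin n) (E ⧸ K)) :=
  Seminorm.quotient (mnorm n : Seminorm ℂ (Matrix (Fin n) (Fin n) E))
    (LinearMap.mapMatrix (K.mkQ.restrictScalars ℂ)) (K.mapMatrix_mkQ_surjective n)

theorem quotientMnorm_mkQ_le {n : ℕ} (x : Matrix (Fin n) (Fin n) E) :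
    quotientMnorm K n (x.map (K.mkQ.restrictScalars ℂ)) ≤ mnorm n x :=
  Seminorm.quotient_apply_le _ _ (K.mapMatrix_mkQ_surjective n) x

variable {K} in
theorem exists_lt_of_quotientMnorm_lt {n : ℕ} {z : Matrix (Fin n) (Fin n) (E ⧸ K)} {r : ℝ}
    (h : quotientMnorm K n z < r) :
    ∃ y : Matrix (Fin n) (Fin n) E, y.map (K.mkQ.restrictScalars ℂ) = z ∧ mnorm n y < r :=
  Seminorm.exists_lt_of_quotient_lt h

variable {K} in
theorem exists_lt_add_of_quotientMnorm {n : ℕ} (z : Matrix (Fin n) (Fin n) (E ⧸ K)) {ε : ℝ}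
    (hε : 0 < ε) : ∃ y : Matrix (Fin n) (Fin n) E, y.map (K.mkQ.restrictScalars ℂ) = z ∧
      mnorm n y < quotientMnorm K n z + ε :=
  exists_lt_of_quotientMnorm_lt (lt_add_of_pos_right _ hε)

variable {K} in
-- Lifts of norm below the quotient norm plus `ε` give the bound up to `ε * B`; then `ε` tends to
-- `0`. The factor `B` is there because the estimates for scalar and module multiplication on a
-- quotient all have this product form.
theorem le_quotientMnorm_mul {n : ℕ} {z : Matrix (Fin n) (Fin n) (E ⧸ K)} {t B : ℝ} (hB : 0 ≤ B)
    (h : ∀ y : Matrix (Fin n) (Fin n) E, y.map (K.mkQ.restrictScalars ℂ) = z →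
      t ≤ mnorm n y * B) : t ≤ quotientMnorm K n z * B := by
  have hc : Filter.Tendsto (fun ε : ℝ => (quotientMnorm K n z + ε) * B)
      (nhdsWithin 0 (Set.Ioi 0)) (nhds ((quotientMnorm K n z + 0) * B)) :=
    Filter.Tendsto.mono_left (Continuous.tendsto (by fun_prop) 0) nhdsWithin_le_nhds
  rw [add_zero] at hc
  refine ge_of_tendsto hc (Filter.eventually_of_mem self_mem_nhdsWithin fun ε hε => ?_)
  obtain ⟨y, hy, hlt⟩ := exists_lt_add_of_quotientMnorm z hε
  exact (h y hy).trans (mul_le_mul_of_nonneg_right hlt.le hB)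

variable [hK : IsClosed (K : Set E)]

open scoped Matrix.Norms.L2Operator in
noncomputable instance OperatorSpace.instQuotient : OperatorSpace (E ⧸ K) where
  mnorm := quotientMnorm K
  mnorm_one x := by
    refine le_antisymm (le_of_forall_pos_lt_add fun ε hε => ?_)
      (le_of_forall_pos_lt_add fun ε hε => ?_)
    · obtain ⟨v, rfl, hv⟩ := Submodule.Quotient.norm_mk_lt x hε
      refine lt_of_le_of_lt ?_ hv
      rw [← mnorm_one v]
      exact quotientMnorm_mkQ_le K (Matrix.of fun _ _ => v)
    · obtain ⟨v, hv, hr⟩ := exists_lt_add_of_quotientMnorm (Matrix.of fun _ _ : Fin 1 => x) hε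
      refine lt_of_le_of_lt ?_ hr
      have h1 : v = Matrix.of fun _ _ => v 0 0 := by
        ext i j
        rw [Subsingleton.elim i 0, Subsingleton.elim j 0]
        rfl
      have h2 : Submodule.Quotient.mk (v 0 0) = x := congrFun (congrFun hv 0) 0
      rw [h1, mnorm_one, ← h2]
      exact Submodule.Quotient.norm_mk_le K _
  mnorm_sandwich_le m n α x β := by
    rw [mul_right_comm, mul_comm]
    refine le_quotientMnorm_mul (by positivity) fun v hv => ?_
    rw [← hv, ← scalarSandwich_map]
    refine (quotientMnorm_mkQ_le K _).trans ((mnorm_sandwich_le m n α v β).trans_eq ?_)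
    ring
  mnorm_blockDiag m n x y := by
    refine le_antisymm (le_of_forall_pos_lt_add fun ε hε => ?_)
      (le_of_forall_pos_lt_add fun ε hε => ?_)
    · obtain ⟨v, hv, hv'⟩ := exists_lt_add_of_quotientMnorm x hε
      obtain ⟨w, hw, hw'⟩ := exists_lt_add_of_quotientMnorm y hε
      rw [← max_add_add_right]
      refine lt_of_le_of_lt ?_ (max_lt_max hv' hw')
      rw [← mnorm_blockDiag, ← hv, ← hw, ← blockDiag_map]
      exact quotientMnorm_mkQ_le K _
    -- A lift of `x ⊕ y` need not be block diagonal, but its two diagonal corners lift `x` and `y`,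
    -- and passing to a corner does not increase the norm.
    · obtain ⟨v, hv, hr⟩ := exists_lt_add_of_quotientMnorm (blockDiag x y) hε
      refine lt_of_le_of_lt (max_le ?_ ?_) hr
      · rw [← blockDiag_submatrix_castAdd x y, ← hv]
        exact (quotientMnorm_mkQ_le K (v.submatrix _ _)).trans
          (mnorm_submatrix_le (Fin.castAdd_injective m n) v)
      · rw [← blockDiag_submatrix_natAdd x y, ← hv]
        exact (quotientMnorm_mkQ_le K (v.submatrix _ _)).trans
          (mnorm_submatrix_le (Fin.natAdd_injective n m) v)

theorem mnorm_mkQ_le {n : ℕ} (x : Matrix (Fin n) (Fin n) E) :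
    mnorm n (x.map (K.mkQ.restrictScalars ℂ)) ≤ mnorm n x :=
  quotientMnorm_mkQ_le K x

variable {K} in
theorem exists_lt_of_mnorm_quotient_lt {n : ℕ} {z : Matrix (Fin n) (Fin n) (E ⧸ K)} {r : ℝ}
    (h : mnorm n z < r) :
    ∃ y : Matrix (Fin n) (Fin n) E, y.map (K.mkQ.restrictScalars ℂ) = z ∧ mnorm n y < r :=
  exists_lt_of_quotientMnorm_lt h

variable {K} in
theorem le_mnorm_quotient_mul {n : ℕ} {z : Matrix (Fin n) (Fin n) (E ⧸ K)} {t B : ℝ} (hB : 0 ≤ B)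
    (h : ∀ y : Matrix (Fin n) (Fin n) E, y.map (K.mkQ.restrictScalars ℂ) = z →
      t ≤ mnorm n y * B) : t ≤ mnorm n z * B :=
  le_quotientMnorm_mul hB h

end OperatorSpaces

/-! ## Kernels and cokernels in `Op_∞` -/

namespace OpSpace

theorem nonempty_isLimit_kernelFork {K X Y : OpSpace.{v}} (i : K ⟶ X) (f : X ⟶ Y)
    (w : i ≫ f = 0) (hinj : Function.Injective i.1)
    (hi : ∀ n (x : Matrix (Fin n) (Fin n) K.carrier), mnorm n x = mnorm n (x.map i.1))
    (hker : ∀ x, f.1 x = 0 → x ∈ LinearMap.range i.1) :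
    Nonempty (IsLimit (KernelFork.ofι i w)) := by
  have : Mono i := ⟨fun a b hab => Subtype.ext <| LinearMap.ext fun x => hinj <|
    LinearMap.congr_fun (congrArg Subtype.val hab) x⟩
  refine ⟨KernelFork.IsLimit.ofι' i w fun {W} k hk => Classical.choice ?_⟩
  obtain ⟨l, hl, h⟩ := k.2.exists_lift hinj hi
    fun x => hker _ (LinearMap.congr_fun (congrArg Subtype.val hk) x)
  exact ⟨⟨l, hl⟩, Subtype.ext (LinearMap.ext h)⟩

/-- A completely bounded map that kills the range of `f` is continuous, so it kills the closure and
hence `ker q`; nearly norm-preserving lifts keep the induced map completely bounded. -/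
theorem nonempty_isColimit_cokernelCofork {X Y Q : OpSpace.{v}} (f : X ⟶ Y) (q : Y ⟶ Q)
    (w : f ≫ q = 0) (hsurj : Function.Surjective q.1)
    (hq : ∀ n (z : Matrix (Fin n) (Fin n) Q.carrier) (r : ℝ), mnorm n z < r →
      ∃ y : Matrix (Fin n) (Fin n) Y.carrier, y.map q.1 = z ∧ mnorm n y < r)
    (hker : ∀ y, q.1 y = 0 → y ∈ closure (Set.range f.1)) :
    Nonempty (IsColimit (CokernelCofork.ofπ q w)) := by
  have : Epi q := ⟨fun a b hab => Subtype.ext <| LinearMap.ext <| hsurj.forall.2 fun x =>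
    LinearMap.congr_fun (congrArg Subtype.val hab) x⟩
  refine ⟨CokernelCofork.IsColimit.ofπ' q w fun {W} k hk => Classical.choice ?_⟩
  have hk0 : closure (Set.range f.1) ⊆ {y | k.1 y = 0} :=
    closure_minimal (Set.range_subset_iff.2 fun x => LinearMap.congr_fun (congrArg Subtype.val hk) x)
      (isClosed_singleton.preimage k.2.continuous)
  obtain ⟨l, hl, h⟩ := k.2.exists_desc hsurj hq fun y hy => hk0 (hker y hy)
  exact ⟨⟨l, hl⟩, Subtype.ext (LinearMap.ext h)⟩

end OpSpace

/-! ## Submodules, quotients and products of operator space modules -/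

namespace OpSpaceModule

section

variable {A : Type u} [Ring A] [Algebra ℂ A]

/-- A closed submodule. -/
noncomputable abbrev sub (E : OpSpaceModule.{u, v} A) (K : Submodule Aᵐᵒᵖ E.carrier)
    (hK : IsClosed (K : Set E.carrier)) : OpSpaceModule.{u, v} A :=
  have : CompleteSpace K := hK.completeSpace_coe
  { carrier := K }

/-- The quotient by a closed submodule. -/
noncomputable abbrev quotient (E : OpSpaceModule.{u, v} A) (K : Submodule Aᵐᵒᵖ E.carrier)
    (hK : IsClosed (K : Set E.carrier)) : OpSpaceModule.{u, v} A :=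
  { carrier := E.carrier ⧸ K }

/-- The product of two modules. -/
noncomputable abbrev prod (E F : OpSpaceModule.{u, v} A) : OpSpaceModule.{u, v} A :=
  { carrier := E.carrier × F.carrier }

/-- The `A`-linear map underlying a morphism. -/
def toLinear {E F : OpSpaceModule.{u, v} A} (f : E ⟶ F) : E.carrier →ₗ[Aᵐᵒᵖ] F.carrier where
  toFun := f.1
  map_add' := f.1.map_add
  map_smul' a x := f.2.2 a.unop x

theorem continuous_toLinear {E F : OpSpaceModule.{u, v} A} (f : E ⟶ F) :
    Continuous (toLinear f) :=
  f.2.1.continuous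

theorem isClosed_ker_toLinear {E F : OpSpaceModule.{u, v} A} (f : E ⟶ F) :
    IsClosed (LinearMap.ker (toLinear f) : Set E.carrier) :=
  isClosed_singleton.preimage (continuous_toLinear f)

/-- The inclusion of a closed submodule. -/
noncomputable def subι (E : OpSpaceModule.{u, v} A) (K : Submodule Aᵐᵒᵖ E.carrier)
    (hK : IsClosed (K : Set E.carrier)) : E.sub K hK ⟶ E :=
  ⟨K.subtype.restrictScalars ℂ, ⟨1, fun _ _ => (one_mul _).ge⟩, fun _ _ => rfl⟩

/-- The projection onto the quotient by a closed submodule. -/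
noncomputable def quotientπ (E : OpSpaceModule.{u, v} A) (K : Submodule Aᵐᵒᵖ E.carrier)
    (hK : IsClosed (K : Set E.carrier)) : E ⟶ E.quotient K hK :=
  ⟨K.mkQ.restrictScalars ℂ, ⟨1, fun _ x => (mnorm_mkQ_le K x).trans_eq (one_mul _).symm⟩,
    fun _ _ => rfl⟩

theorem isIso_of_isIso_forget {E F : OpSpaceModule.{u, v} A} (f : E ⟶ F)
    [IsIso ((forget A).map f)] : IsIso f := by
  have h1 : ∀ x, (inv ((forget A).map f)).1 (f.1 x) = x := fun x =>
    LinearMap.congr_fun (congrArg Subtype.val (IsIso.hom_inv_id ((forget A).map f))) x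
  have h2 : ∀ x, f.1 ((inv ((forget A).map f)).1 x) = x := fun x =>
    LinearMap.congr_fun (congrArg Subtype.val (IsIso.inv_hom_id ((forget A).map f))) x
  refine ⟨⟨(inv ((forget A).map f)).1, (inv ((forget A).map f)).2, fun a x => ?_⟩,
    Subtype.ext (LinearMap.ext h1), Subtype.ext (LinearMap.ext h2)⟩
  -- The linear inverse of a bijective `A`-linear map is `A`-linear.
  refine (congrArg (inv ((forget A).map f)).1 ?_).trans (h1 _)
  exact ((f.2.2 a _).trans (congrArg (MulOpposite.op a • ·) (h2 x))).symm

instance : (forget.{u, v} A).ReflectsIsomorphisms :=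
  ⟨fun f _ => isIso_of_isIso_forget f⟩

/-- A class of modules with continuous action that is stable under closed submodules, quotients
and products. -/
structure IsStable (T : ObjectProperty (OpSpaceModule.{u, v} A)) : Prop where
  continuousConstSMul : ∀ E, T E → ContinuousConstSMul Aᵐᵒᵖ E.carrier
  sub : ∀ E K hK, T E → T (E.sub K hK)
  quotient : ∀ E K hK, T E → T (E.quotient K hK)
  prod : ∀ E F, T E → T F → T (E.prod F)

variable {T : ObjectProperty (OpSpaceModule.{u, v} A)}

/-- As in `Op_∞`; the lift is moreover `A`-linear, which can be tested after the injective
`A`-linear map `i`. -/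
theorem nonempty_isLimit_kernelFork {K X Y : T.FullSubcategory} (i : K ⟶ X) (f : X ⟶ Y)
    (w : i ≫ f = 0) (hinj : Function.Injective i.hom.1)
    (hi : ∀ n (x : Matrix (Fin n) (Fin n) K.obj.carrier), mnorm n x = mnorm n (x.map i.hom.1))
    (hker : ∀ x, f.hom.1 x = 0 → x ∈ LinearMap.range i.hom.1) :
    Nonempty (IsLimit (KernelFork.ofι i w)) := by
  have : Mono i := ⟨fun a b hab => ObjectProperty.hom_ext _ <| Subtype.ext <| LinearMap.ext fun x =>
    hinj <| LinearMap.congr_fun (congrArg (fun f => f.hom.1) hab) x⟩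
  refine ⟨KernelFork.IsLimit.ofι' i w fun {W} k hk => Classical.choice ?_⟩
  obtain ⟨l, hl, h⟩ := k.hom.2.1.exists_lift hinj hi
    fun x => hker _ (LinearMap.congr_fun (congrArg (fun f => f.hom.1) hk) x)
  refine ⟨⟨⟨l, hl, fun a x => hinj ?_⟩⟩, ObjectProperty.hom_ext _ <| Subtype.ext (LinearMap.ext h)⟩
  rw [h, i.hom.2.2, h, k.hom.2.2]

theorem nonempty_isColimit_cokernelCofork {X Y Q : T.FullSubcategory} (f : X ⟶ Y) (q : Y ⟶ Q)
    (w : f ≫ q = 0) (hsurj : Function.Surjective q.hom.1)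
    (hq : ∀ n (z : Matrix (Fin n) (Fin n) Q.obj.carrier) (r : ℝ), mnorm n z < r →
      ∃ y : Matrix (Fin n) (Fin n) Y.obj.carrier, y.map q.hom.1 = z ∧ mnorm n y < r)
    (hker : ∀ y, q.hom.1 y = 0 → y ∈ closure (Set.range f.hom.1)) :
    Nonempty (IsColimit (CokernelCofork.ofπ q w)) := by
  have : Epi q := ⟨fun a b hab => ObjectProperty.hom_ext _ <| Subtype.ext <| LinearMap.ext <|
    hsurj.forall.2 fun x => LinearMap.congr_fun (congrArg (fun f => f.hom.1) hab) x⟩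
  refine ⟨CokernelCofork.IsColimit.ofπ' q w fun {W} k hk => Classical.choice ?_⟩
  have hk0 : closure (Set.range f.hom.1) ⊆ {y | k.hom.1 y = 0} :=
    closure_minimal (Set.range_subset_iff.2 fun x =>
        LinearMap.congr_fun (congrArg (fun g : X ⟶ W => g.hom.1) hk) x)
      (isClosed_singleton.preimage k.hom.2.1.continuous)
  obtain ⟨l, hl, h⟩ := k.hom.2.1.exists_desc hsurj hq fun y hy => hk0 (hker y hy)
  refine ⟨⟨⟨l, hl, fun a => hsurj.forall.2 fun x => ?_⟩⟩,
    ObjectProperty.hom_ext _ <| Subtype.ext (LinearMap.ext h)⟩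
  rw [← q.hom.2.2, h, h, k.hom.2.2]

/-! ### Kernels, cokernels and biproducts in a stable class -/

namespace IsStable

/-- The same closed submodule is a kernel among the modules and in `Op_∞`. Stating both at once
yields existence of kernels and their preservation by the forgetful functor. -/
theorem exists_kernel (hT : IsStable T) {X Y : T.FullSubcategory} (f : X ⟶ Y) :
    ∃ (K : T.FullSubcategory) (i : K ⟶ X) (w : i ≫ f = 0),
      Nonempty (IsLimit (KernelFork.ofι i w)) ∧
      Nonempty (IsLimit ((T.ι ⋙ forget A).mapCone (KernelFork.ofι i w))) := by
  let i : (⟨_, hT.sub X.obj _ (isClosed_ker_toLinear f.hom) X.property⟩ : T.FullSubcategory) ⟶ X :=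
    ⟨X.obj.subι (LinearMap.ker (toLinear f.hom)) (isClosed_ker_toLinear f.hom)⟩
  have w : i ≫ f = 0 := ObjectProperty.hom_ext _ <| Subtype.ext <| LinearMap.ext fun x => x.2
  have hinj : Function.Injective i.hom.1 := Subtype.val_injective
  have hker : ∀ x, f.hom.1 x = 0 → x ∈ LinearMap.range i.hom.1 := fun x hx => ⟨⟨x, hx⟩, rfl⟩
  obtain ⟨h⟩ := OpSpace.nonempty_isLimit_kernelFork ((T.ι ⋙ forget A).map i)
    ((T.ι ⋙ forget A).map f) (by rw [← Functor.map_comp, w, Functor.map_zero]) hinj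
    (fun _ _ => rfl) hker
  exact ⟨_, i, w, nonempty_isLimit_kernelFork i f w hinj (fun _ _ => rfl) hker,
    ⟨(isLimitMapConeForkEquiv' _ w).symm h⟩⟩

theorem exists_cokernel (hT : IsStable T) {X Y : T.FullSubcategory} (f : X ⟶ Y) :
    ∃ (Q : T.FullSubcategory) (q : Y ⟶ Q) (w : f ≫ q = 0),
      Nonempty (IsColimit (CokernelCofork.ofπ q w)) ∧
      Nonempty (IsColimit ((T.ι ⋙ forget A).mapCocone (CokernelCofork.ofπ q w))) := by
  -- Continuity of the action makes the closure of the range an `A`-submodule.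
  have := hT.continuousConstSMul Y.obj Y.property
  let S := (LinearMap.range (toLinear f.hom)).topologicalClosure
  have hS : IsClosed (S : Set Y.obj.carrier) := Submodule.isClosed_topologicalClosure _
  let q : Y ⟶ (⟨_, hT.quotient Y.obj S hS Y.property⟩ : T.FullSubcategory) :=
    ⟨Y.obj.quotientπ S hS⟩
  have w : f ≫ q = 0 := ObjectProperty.hom_ext _ <| Subtype.ext <| LinearMap.ext fun x =>
    (Submodule.Quotient.mk_eq_zero S).2 (Submodule.le_topologicalClosure _ ⟨x, rfl⟩)
  have hsurj : Function.Surjective q.hom.1 := S.mkQ_surjective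
  have hker : ∀ y, q.hom.1 y = 0 → y ∈ closure (Set.range f.hom.1) := fun y hy =>
    (Submodule.Quotient.mk_eq_zero S).1 hy
  obtain ⟨h⟩ := OpSpace.nonempty_isColimit_cokernelCofork ((T.ι ⋙ forget A).map f)
    ((T.ι ⋙ forget A).map q) (by rw [← Functor.map_comp, w, Functor.map_zero]) hsurj
    (fun _ _ _ => exists_lt_of_mnorm_quotient_lt) hker
  exact ⟨_, q, w, nonempty_isColimit_cokernelCofork f q w hsurj
    (fun _ _ _ => exists_lt_of_mnorm_quotient_lt) hker,
    ⟨(isColimitMapCoconeCoforkEquiv' _ w).symm h⟩⟩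

theorem hasBinaryBiproducts (hT : IsStable T) : HasBinaryBiproducts T.FullSubcategory where
  has_binary_biproduct X Y := hasBinaryBiproduct_of_total
    { pt := ⟨X.obj.prod Y.obj, hT.prod _ _ X.property Y.property⟩
      fst := ⟨LinearMap.fst ℂ _ _, .fst, fun _ _ => rfl⟩
      snd := ⟨LinearMap.snd ℂ _ _, .snd, fun _ _ => rfl⟩
      inl := ⟨LinearMap.prod LinearMap.id 0, .prod .id .zero, fun a _ =>
        Prod.ext rfl (smul_zero (MulOpposite.op a)).symm⟩
      inr := ⟨LinearMap.prod 0 LinearMap.id, .prod .zero .id, fun a _ =>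
        Prod.ext (smul_zero (MulOpposite.op a)).symm rfl⟩
      inl_fst := rfl
      inl_snd := rfl
      inr_fst := rfl
      inr_snd := rfl } <|
    ObjectProperty.hom_ext _ <| Subtype.ext <| LinearMap.ext fun x =>
      Prod.ext (add_zero x.1) (zero_add x.2)

theorem isInjectiveFor (hT : IsStable T) {I : T.FullSubcategory}
    (hrel : IsInjectiveFor (exactRel (T.ι ⋙ forget A)) I)
    (hmax : IsInjectiveFor (exactMax OpSpace.{v}) ((T.ι ⋙ forget A).obj I)) :
    IsInjectiveFor (exactMax T.FullSubcategory) I := by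
  have hK : HasKernels T.FullSubcategory := ⟨fun f => by
    obtain ⟨K, i, w, ⟨h⟩, -⟩ := hT.exists_kernel f
    exact ⟨⟨_, h⟩⟩⟩
  have hQ : HasCokernels T.FullSubcategory := ⟨fun f => by
    obtain ⟨Q, q, w, ⟨h⟩, -⟩ := hT.exists_cokernel f
    exact ⟨⟨_, h⟩⟩⟩
  have hB := hT.hasBinaryBiproducts
  have hpK : ∀ {X Y : T.FullSubcategory} (f : X ⟶ Y),
      PreservesLimit (parallelPair f 0) (T.ι ⋙ forget A) := fun f => by
    obtain ⟨K, i, w, ⟨h⟩, ⟨h'⟩⟩ := hT.exists_kernel f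
    exact preservesLimit_of_preserves_limit_cone h h'
  have hpQ : ∀ {X Y : T.FullSubcategory} (f : X ⟶ Y),
      PreservesColimit (parallelPair f 0) (T.ι ⋙ forget A) := fun f => by
    obtain ⟨Q, q, w, ⟨h⟩, ⟨h'⟩⟩ := hT.exists_cokernel f
    exact preservesColimit_of_preserves_colimit_cocone h h'
  have hι : T.ι.ReflectsIsomorphisms :=
    ⟨fun f _ => (T.isIso_hom_iff f).1 (inferInstanceAs (IsIso (T.ι.map f)))⟩
  have hR : (T.ι ⋙ forget A).ReflectsIsomorphisms := reflectsIsomorphisms_comp _ _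
  exact isInjectiveFor_exactMax_of_exactRel (T.ι ⋙ forget A) hrel hmax

end IsStable

end

/-! ### Stability of operator modules and matrix normed modules -/

section

variable {A : Type u} [NormedRing A] [NormedAlgebra ℂ A] [CompleteSpace A]
  [UnitalOperatorAlgebra A]

omit [CompleteSpace A] [UnitalOperatorAlgebra A] in
theorem continuousConstSMul_of_norm_smul_le {E : OpSpaceModule.{u, v} A}
    (h : ∀ (a : A) (x : E.carrier), ‖MulOpposite.op a • x‖ ≤ ‖x‖ * ‖a‖) :
    ContinuousConstSMul Aᵐᵒᵖ E.carrier where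
  continuous_const_smul a := AddMonoidHomClass.continuous_of_bound
    (DistribSMul.toAddMonoidHom E.carrier a) ‖a.unop‖ fun x => (h a.unop x).trans_eq (mul_comm _ _)

section

variable {E F : Type*} [AddCommGroup E] [Module Aᵐᵒᵖ E] [AddCommGroup F] [Module Aᵐᵒᵖ F]

/-- The matrix product `[∑ₖ x i k · a k j]`. -/
def matrixSMul {n : ℕ} (x : Matrix (Fin n) (Fin n) E) (a : Matrix (Fin n) (Fin n) A) :
    Matrix (Fin n) (Fin n) E :=
  Matrix.of fun i j => ∑ k, MulOpposite.op (a k j) • x i k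

/-- The Kronecker product `[x i j · a k l]`. -/
def kroneckerSMul {n m : ℕ} (x : Matrix (Fin n) (Fin n) E) (a : Matrix (Fin m) (Fin m) A) :
    Matrix (Fin (n * m)) (Fin (n * m)) E :=
  Matrix.reindex finProdFinEquiv finProdFinEquiv
    (Matrix.of fun (p q : Fin n × Fin m) => MulOpposite.op (a p.2 q.2) • x p.1 q.1)

omit [NormedAlgebra ℂ A] [CompleteSpace A] [UnitalOperatorAlgebra A] in
theorem matrixSMul_map (f : E →ₗ[Aᵐᵒᵖ] F) {n : ℕ} (x : Matrix (Fin n) (Fin n) E)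
    (a : Matrix (Fin n) (Fin n) A) : (matrixSMul x a).map f = matrixSMul (x.map f) a := by
  ext i j
  simp [matrixSMul, map_sum]

omit [NormedAlgebra ℂ A] [CompleteSpace A] [UnitalOperatorAlgebra A] in
theorem kroneckerSMul_map (f : E →ₗ[Aᵐᵒᵖ] F) {n m : ℕ} (x : Matrix (Fin n) (Fin n) E)
    (a : Matrix (Fin m) (Fin m) A) : (kroneckerSMul x a).map f = kroneckerSMul (x.map f) a := by
  ext i j
  simp [kroneckerSMul]

end

theorem mnorm_matrixSMul_prod_le {E F : Type*} [NormedAddCommGroup E] [NormedSpace ℂ E]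
    [OperatorSpace E] [Module Aᵐᵒᵖ E] [NormedAddCommGroup F] [NormedSpace ℂ F] [OperatorSpace F]
    [Module Aᵐᵒᵖ F]
    (hE : ∀ (n : ℕ) (x : Matrix (Fin n) (Fin n) E) (a : Matrix (Fin n) (Fin n) A),
      mnorm n (matrixSMul x a) ≤ mnorm n x * mnorm n a)
    (hF : ∀ (n : ℕ) (x : Matrix (Fin n) (Fin n) F) (a : Matrix (Fin n) (Fin n) A),
      mnorm n (matrixSMul x a) ≤ mnorm n x * mnorm n a)
    (n : ℕ) (x : Matrix (Fin n) (Fin n) (E × F)) (a : Matrix (Fin n) (Fin n) A) :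
    mnorm n (matrixSMul x a) ≤ mnorm n x * mnorm n a := by
  refine mnorm_prod_le_mul (apply_nonneg _ _) ?_ ?_
  · exact (congrArg (mnorm n) (matrixSMul_map (LinearMap.fst Aᵐᵒᵖ E F) x a)).trans_le (hE n _ a)
  · exact (congrArg (mnorm n) (matrixSMul_map (LinearMap.snd Aᵐᵒᵖ E F) x a)).trans_le (hF n _ a)

theorem isOperatorModule_iff {E : OpSpaceModule.{u, v} A} : IsOperatorModule A E ↔
    ∀ (n : ℕ) (x : Matrix (Fin n) (Fin n) E.carrier) (a : Matrix (Fin n) (Fin n) A),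
      mnorm n (matrixSMul x a) ≤ mnorm n x * mnorm n a :=
  Iff.rfl

theorem isMatrixNormedModule_iff {E : OpSpaceModule.{u, v} A} : IsMatrixNormedModule A E ↔
    ∀ (n m : ℕ) (x : Matrix (Fin n) (Fin n) E.carrier) (a : Matrix (Fin m) (Fin m) A),
      mnorm (n * m) (kroneckerSMul x a) ≤ mnorm n x * mnorm m a :=
  Iff.rfl

variable (A)

theorem isStable_isOperatorModule : IsStable (IsOperatorModule.{u, v} A) where
  continuousConstSMul E hE := continuousConstSMul_of_norm_smul_le fun a x => by
    have h := isOperatorModule_iff.1 hE 1 (Matrix.of fun _ _ => x) (Matrix.of fun _ _ => a)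
    have h1 : matrixSMul (Matrix.of fun _ _ : Fin 1 => x) (Matrix.of fun _ _ => a) =
        Matrix.of fun _ _ => MulOpposite.op a • x := by
      ext i j
      simp [matrixSMul]
    rwa [h1, OperatorSpace.mnorm_one, OperatorSpace.mnorm_one, OperatorSpace.mnorm_one] at h
  sub E K hK hE := isOperatorModule_iff.2 fun n x a =>
    (congrArg (mnorm n) (matrixSMul_map K.subtype x a)).trans_le
      (isOperatorModule_iff.1 hE n (x.map K.subtype) a)
  quotient E K hK hE := isOperatorModule_iff.2 fun n x a =>
    -- For every lift `y` of `x`, the product of `y` with `a` lifts that of `x` with `a`, so the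
    -- bound in `E` passes to the infimum over lifts.
    le_mnorm_quotient_mul (apply_nonneg _ _) fun y hy => by
      rw [← hy]
      exact (congrArg (mnorm n) (matrixSMul_map K.mkQ y a)).symm.trans_le
        ((mnorm_mkQ_le K _).trans (isOperatorModule_iff.1 hE n y a))
  prod E F hE hF := isOperatorModule_iff.2 (mnorm_matrixSMul_prod_le
    (isOperatorModule_iff.1 hE) (isOperatorModule_iff.1 hF))

theorem isStable_isMatrixNormedModule : IsStable (IsMatrixNormedModule.{u, v} A) where
  continuousConstSMul E hE := continuousConstSMul_of_norm_smul_le fun a x => by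
    have h := isMatrixNormedModule_iff.1 hE 1 1 (Matrix.of fun _ _ => x) (Matrix.of fun _ _ => a)
    -- The size `1 * 1` reduces to `1`, so both sides agree definitionally.
    have h1 : kroneckerSMul (Matrix.of fun _ _ : Fin 1 => x) (Matrix.of fun _ _ : Fin 1 => a) =
        Matrix.of fun _ _ => MulOpposite.op a • x :=
      rfl
    have h2 : ‖x‖ * mnorm 1 (Matrix.of fun _ _ => a) = ‖x‖ * ‖a‖ := by
      rw [OperatorSpace.mnorm_one]
    rw [h1, OperatorSpace.mnorm_one x, h2] at h
    exact (OperatorSpace.mnorm_one _).symm.trans_le h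
  sub E K hK hE := isMatrixNormedModule_iff.2 fun n m x a =>
    (congrArg (mnorm (n * m)) (kroneckerSMul_map K.subtype x a)).trans_le
      (isMatrixNormedModule_iff.1 hE n m (x.map K.subtype) a)
  quotient E K hK hE := isMatrixNormedModule_iff.2 fun n m x a =>
    le_mnorm_quotient_mul (apply_nonneg _ _) fun y hy => by
      rw [← hy]
      exact (congrArg (mnorm (n * m)) (kroneckerSMul_map K.mkQ y a)).symm.trans_le
        ((mnorm_mkQ_le K _).trans (isMatrixNormedModule_iff.1 hE n m y a))
  prod E F hE hF := isMatrixNormedModule_iff.2 fun n m x a =>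
    mnorm_prod_le_mul (apply_nonneg _ _)
      ((congrArg (mnorm (n * m)) (kroneckerSMul_map (LinearMap.fst Aᵐᵒᵖ _ _) x a)).trans_le
        (isMatrixNormedModule_iff.1 hE n m (x.map Prod.fst) a))
      ((congrArg (mnorm (n * m)) (kroneckerSMul_map (LinearMap.snd Aᵐᵒᵖ _ _) x a)).trans_le
        (isMatrixNormedModule_iff.1 hF n m (x.map Prod.snd) a))

end

end OpSpaceModule

theorem mainTheorem9 (A : Type u) [NormedRing A] [NormedAlgebra ℂ A] [CompleteSpace A]
    [UnitalOperatorAlgebra A] :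
    (∀ E : OMod.{u, v} A,
      IsInjectiveFor (exactRel (OMod.forget.{u, v} A)) E →
      IsInjectiveFor (exactMax OpSpace.{v}) ((OMod.forget.{u, v} A).obj E) →
      IsInjectiveFor (exactMax (OMod.{u, v} A)) E) ∧
    (∀ E : MnMod.{u, v} A,
      IsInjectiveFor (exactRel (MnMod.forget.{u, v} A)) E →
      IsInjectiveFor (exactMax OpSpace.{v}) ((MnMod.forget.{u, v} A).obj E) →
      IsInjectiveFor (exactMax (MnMod.{u, v} A)) E) :=
  ⟨fun _ => (OpSpaceModule.isStable_isOperatorModule A).isInjectiveFor,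
    fun _ => (OpSpaceModule.isStable_isMatrixNormedModule A).isInjectiveFor⟩
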